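/- **Setting.** Let $r_a,\omega_b,\sigma_s>0$, let $a_{\rm abs},b_{\rm scat},d$ be real (absorption and scattering coefficients, distance), let $\alpha\in[0,1]$ and $\beta,a,b,c>0$. Put $$h_a=e^{-(a_{\rm abs}+b_{\rm scat})d},\quad v=\frac{r_a\sqrt{\pi/2}}{\omega_b},\quad A_0=\operatorname{erf}(v)^2,\quad \omega_e=\omega_b\sqrt{\frac{\sqrt\pi\,\operatorname{erf}(v)}{2v e^{-v^2}}},\quad \mu_s=\frac{\omega_e}{2\sigma_s}.$$ The gain of link $i\in\{1,2\}$ is $h_i=h_a\,h_{t,i}\,h_{p,i}$, where the turbulence fading $h_{t,i}$ has the mixture exponential-generalized Gamma density $$\frac{\alpha}{\beta}e^{-x/\beta}+(1-\alpha)\frac{c\,x^{ac-1}}{b^{ac}\Gamma(a)}e^{-(x/b)^c},\qquad x>0,$$ the pointing loss is $h_{p,i}=A_0\exp(-2r_i^2/\omega_e^2)$, with $r_i$ the Euclidean length of a planar Gaussian vector with independent centred coordinates of variance $\sigma_s^2$, and $h_{t,i}$ is independent of that vector. The gains $h_1$ and $h_2$ are independent (hence i.i.d.). For $z>0$ let $${\rm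 H}^{4,0}_{2,4}\Bigl[z\Bigm|\begin{smallmatrix}(a_1,A_1),(a_2,A_2)\\(b_1,B_1),\dots,(b_4,B_4)\end{smallmatrix}\Bigr]=\frac1{2\pi i}\int_{\mathcal L}\frac{\prod_{j=1}^4\Gamma(b_j-B_js)}{\prod_{j=1}^2\Gamma(a_j-A_js)}\,z^s\,ds,$$ with $\mathcal L$ a vertical line (traversed upwards) that has all poles of the numerator on its right, and let ${\rm G}^{4,0}_{2,4}$ be the case of all $A_j=B_j=1$. **Theorem.** The composite gain $h=h_1h_2$ has a probability density function $f_h$, which vanishes on $(-\infty,0]$ and is given for $x>0$ by $$\begin{aligned}f_h(x)&=\frac{(\alpha\mu_s^2)^2}{x}\,{\rm G}_{2,4}^{4,0}\Bigl[\frac{x}{(A_0h_a\beta)^2}\Bigm|\begin{smallmatrix}\mu_s^2+1,\ \mu_s^2+1\\1,\ \mu_s^2,\ 1,\ \mu_s^2\end{smallmatrix}\Bigr]\\&\quad+\frac{2\alpha(1-\alpha)\mu_s^4}{\Gamma(a)c^2x}\,{\rm H}_{2,4}^{4,0}\Bigl[\frac{x}{(A_0h_a)^2\beta b}\Bigm|\begin{smallmatrix}(\mu_s^2/c+1,\,1/c),\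 (\mu_s^2/c+1,\,1/c)\\(a,\,1/c),\ (\mu_s^2/c,\,1/c),\ (1,\,1),\ (\mu_s^2/c,\,1/c)\end{smallmatrix}\Bigr]\\&\quad+\Bigl[\frac{(1-\alpha)\mu_s^2}{\Gamma(a)}\Bigr]^2\frac1{cx}\,{\rm G}_{2,4}^{4,0}\Bigl[\Bigl(\frac{x}{(A_0h_ab)^2}\Bigr)^{c}\Bigm|\begin{smallmatrix}\mu_s^2/c+1,\ \mu_s^2/c+1\\a,\ \mu_s^2/c,\ a,\ \mu_s^2/c\end{smallmatrix}\Bigr],\end{aligned}$$ where for every $x>0$ the three contour integrals converge absolutely along every admissible vertical line, with values that do not depend on the line. -/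

import Mathlib

open MeasureTheory ProbabilityTheory

noncomputable section

/-! ### Fox H and Meijer G functions (Mellin-Barnes integrals, positive argument) -/

/-- Mellin-Barnes kernel of the Fox function `H^{m,n}_{p,q}` with upper parameters
`a = [(a₁, A₁), …, (a_p, A_p)]` and lower parameters `b = [(b₁, B₁), …, (b_q, B_q)]`:
`∏_{j ≤ m} Γ(b_j - B_j s) ∏_{j ≤ n} Γ(1 - a_j + A_j s)`
`/ (∏_{j > m} Γ(1 - b_j + B_j s) ∏_{j > n} Γ(a_j - A_j s))`. -/
def foxHKernel (m n : ℕ) (a b : List (ℝ × ℝ)) (s : ℂ) : ℂ :=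
  (((b.take m).map fun p => Complex.Gamma (p.1 - p.2 * s)).prod *
      ((a.take n).map fun p => Complex.Gamma (1 - p.1 + p.2 * s)).prod) /
    (((b.drop m).map fun p => Complex.Gamma (1 - p.1 + p.2 * s)).prod *
      ((a.drop n).map fun p => Complex.Gamma (p.1 - p.2 * s)).prod)

/-- The vertical line `Re s = σ` has all poles of `Γ(b_j - B_j s)`, `j ≤ m`, on its right and
all poles of `Γ(1 - a_j + A_j s)`, `j ≤ n`, on its left (the weights being positive). -/
def SeparatesPoles (m n : ℕ) (a b : List (ℝ × ℝ)) (σ : ℝ) : Prop :=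
  (∀ p ∈ b.take m, 0 < p.1 - p.2 * σ) ∧ (∀ p ∈ a.take n, 0 < 1 - p.1 + p.2 * σ)

/-- The Mellin-Barnes integrand `kernel(s) z ^ s` at the point `s = σ + i t` of the line. -/
def foxHIntegrand (m n : ℕ) (a b : List (ℝ × ℝ)) (z σ t : ℝ) : ℂ :=
  foxHKernel m n a b (σ + t * Complex.I) * (z : ℂ) ^ ((σ : ℂ) + t * Complex.I)

/-- `(1 / 2πi) ∫ kernel(s) z ^ s ds` along the line `Re s = σ`, traversed upwards. -/
def foxHLine (m n : ℕ) (a b : List (ℝ × ℝ)) (z σ : ℝ) : ℂ :=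
  (1 / (2 * Real.pi) : ℂ) * ∫ t : ℝ, foxHIntegrand m n a b z σ t

open scoped Classical in
/-- The Fox function `H^{m,n}_{p,q}[z | a; b]` for `z > 0`: the Mellin-Barnes integral along a
vertical line that separates the poles. -/
def foxH (m n : ℕ) (a b : List (ℝ × ℝ)) (z : ℝ) : ℂ :=
  if h : ∃ σ : ℝ, SeparatesPoles m n a b σ then foxHLine m n a b z h.choose else 0

/-- The Mellin-Barnes definition of `H^{m,n}_{p,q}[z | a; b]` is meaningful: a separating line
exists, and along each such line the integral converges absolutely, with the same value. -/
def FoxHWellDefined (m n : ℕ) (a b : List (ℝ × ℝ)) (z : ℝ) : Prop :=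
  (∃ σ : ℝ, SeparatesPoles m n a b σ) ∧
    ∀ σ : ℝ, SeparatesPoles m n a b σ →
      Integrable (foxHIntegrand m n a b z σ) ∧ foxHLine m n a b z σ = foxH m n a b z

/-- Parameters of a Meijer function as Fox parameters: all weights equal `1`. -/
def unitWeights (a : List ℝ) : List (ℝ × ℝ) := a.map fun x => (x, 1)

/-- The Meijer function `G^{m,n}_{p,q}[z | a₁, …, a_p; b₁, …, b_q]`, that is `(1 / 2πi) ∫` of
`z ^ s ∏_{j ≤ m} Γ(b_j - s) ∏_{j ≤ n} Γ(1 - a_j + s)`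
`/ (∏_{j > m} Γ(1 - b_j + s) ∏_{j > n} Γ(a_j - s))`. -/
def meijerG (m n : ℕ) (a b : List ℝ) (z : ℝ) : ℂ :=
  foxH m n (unitWeights a) (unitWeights b) z

/-- The Mellin-Barnes definition of `G^{m,n}_{p,q}[z | a; b]` is meaningful. -/
def MeijerGWellDefined (m n : ℕ) (a b : List ℝ) (z : ℝ) : Prop :=
  FoxHWellDefined m n (unitWeights a) (unitWeights b) z

/-! ### The underwater optical channel -/

/-- Density of the mixture exponential-generalized Gamma (EGG) law. -/
def eggPDF (α β a b c x : ℝ) : ℝ :=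
  if 0 < x then
    α / β * Real.exp (-x / β) +
      (1 - α) * (c * x ^ (a * c - 1) / (b ^ (a * c) * Real.Gamma a)) * Real.exp (-(x / b) ^ c)
  else 0

/-- The mixture EGG law. -/
def eggMeasure (α β a b c : ℝ) : Measure ℝ :=
  volume.withDensity fun x => ENNReal.ofReal (eggPDF α β a b c x)

/-- Law of the beam displacement: two independent centred Gaussian coordinates, variance `σs²`. -/
def jitterMeasure (σs : ℝ) : Measure (ℝ × ℝ) :=
  (gaussianReal 0 (σs ^ 2).toNNReal).prod (gaussianReal 0 (σs ^ 2).toNNReal)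

/-- Beer-Lambert attenuation over the distance `d`, with absorption coefficient `kAbs` and
scattering coefficient `kScat`. -/
def attenuation (kAbs kScat d : ℝ) : ℝ := Real.exp (-((kAbs + kScat) * d))

/-- The error function. -/
def erf (x : ℝ) : ℝ := 2 / √Real.pi * ∫ t in (0 : ℝ)..x, Real.exp (-t ^ 2)

/-- `v = r_a √(π/2) / ω_b` for aperture radius `ra` and beam waist `ωb`. -/
def apertureRatio (ra ωb : ℝ) : ℝ := ra * √(Real.pi / 2) / ωb

/-- `A₀ = erf(v)²`, the collected power fraction under perfect alignment. -/
def maxCollectedPower (ra ωb : ℝ) : ℝ := erf (apertureRatio ra ωb) ^ 2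

/-- `ω_e = ω_b √(√π erf(v) / (2 v exp(-v²)))`, the equivalent beam width. -/
def equivBeamWidth (ra ωb : ℝ) : ℝ :=
  ωb * √(√Real.pi * erf (apertureRatio ra ωb) /
    (2 * apertureRatio ra ωb * Real.exp (-apertureRatio ra ωb ^ 2)))

/-- Pointing loss `h_p = A₀ exp(-2 r² / ω_e²)` at beam displacement `u`, where `r` is the
Euclidean length of `u`. -/
def pointingLoss (ra ωb : ℝ) (u : ℝ × ℝ) : ℝ :=
  maxCollectedPower ra ωb *
    Real.exp (-(2 * √(u.1 ^ 2 + u.2 ^ 2) ^ 2) / equivBeamWidth ra ωb ^ 2)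

/-- Channel gain `h_a h_t h_p` of one link, with turbulence fading `T` and beam displacement `U`. -/
def channelGain {Ω : Type*} (ha ra ωb : ℝ) (T : Ω → ℝ) (U : Ω → ℝ × ℝ) (ω : Ω) : ℝ :=
  ha * T ω * pointingLoss ra ωb (U ω)

end

/-! Write φ = μ_s² and K = (A₀ h_a)². Since r² is exponentially distributed, V = exp(-2r²/ω_e²) is
distributed as the power 1/φ of a uniform variable, so V₁V₂ has density φ² y^(φ-1) log(1/y) on (0,
1). Hence h₁h₂ = K T₁T₂V₁V₂ has at x > 0 the density x⁻¹ φ² E[L(x / (K T₁T₂))], where L is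
`logKernel φ`.

The Mellin transform of L at u is (u + φ)⁻², so Mellin inversion gives L(y) = (1/2πi) ∫ (φ - s)⁻²
y^s ds on any line Re s = σ < φ. Fubini moves the expectation inside, where generalized Gamma
moments E[T^(-s)] = b^(-s) Γ(a - s/c) / Γ(a) produce the Gamma factors
(`integral_logKernel_genGamma_prod`). As (φ - s)⁻² = Γ(φ - s)² / Γ(φ + 1 - s)², the result is a Fox
function, up to rescaling s. Every admissible line yields the same expectation, so no contour is
shifted.

The EGG law mixes two generalized Gamma laws; expanding the expectation over pairs gives the three
terms, the cross term counted twice. -/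

open MeasureTheory ProbabilityTheory

noncomputable section

open scoped MeasureTheory

/-! ### The logarithmic kernel and its Mellin transform -/

/-- `y ↦ y ^ φ log (1 / y)` on `(0, 1)`, extended by zero. -/
def logKernel (φ y : ℝ) : ℝ := if 0 < y ∧ y < 1 then y ^ φ * -Real.log y else 0

/-- The `max` form makes continuity at y = 1 visible; pointwise Mellin inversion requires it. -/
lemma logKernel_of_pos {φ y : ℝ} (hy : 0 < y) :
    logKernel φ y = y ^ φ * max (-Real.log y) 0 := by
  unfold logKernel
  split_ifs with h
  · rw [max_eq_left]
    linarith [Real.log_nonpos hy.le h.2.le]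
  · have : 1 ≤ y := by
      by_contra h'
      exact h ⟨hy, not_le.1 h'⟩
    rw [max_eq_right, mul_zero]
    linarith [Real.log_nonneg this]

lemma logKernel_nonneg (φ y : ℝ) : 0 ≤ logKernel φ y := by
  unfold logKernel
  split_ifs with h
  · exact mul_nonneg (Real.rpow_nonneg h.1.le _) (by linarith [Real.log_nonpos h.1.le h.2.le])
  · exact le_rfl

@[fun_prop]
lemma measurable_logKernel (φ : ℝ) : Measurable (logKernel φ) := by
  unfold logKernel
  refine Measurable.ite ?_ (by fun_prop) (by fun_prop)
  exact measurableSet_Ioo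

lemma continuousAt_logKernel {φ y : ℝ} (hy : 0 < y) : ContinuousAt (logKernel φ) y := by
  have h : ContinuousAt (fun y : ℝ => y ^ φ * max (-Real.log y) 0) y :=
    (Real.continuousAt_rpow_const _ _ (Or.inl hy.ne')).mul
      ((Real.continuousAt_log hy.ne').neg.max continuousAt_const)
  refine h.congr ?_
  filter_upwards [lt_mem_nhds hy] with z hz
  exact (logKernel_of_pos hz).symm

/-- Differentiating a Mellin transform in s inserts a factor log t. The transform of t^φ on (0, 1]
is 1/(s + φ), and minus its derivative is the value claimed. -/
lemma hasMellin_logKernel {φ : ℝ} {u : ℂ} (h : 0 < u.re + φ) :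
    HasMellin (fun y => (logKernel φ y : ℂ)) u (1 / (u + φ) ^ 2) := by
  set f : ℝ → ℂ := Set.indicator (Set.Ioc 0 1) (fun t => (t : ℂ) ^ (φ : ℂ)) with hf
  have hm : ∀ s : ℂ, 0 < s.re + φ → HasMellin f s (1 / (s + φ)) := fun s hs =>
    hasMellin_cpow_Ioc _ (by simpa using hs)
  have hloc : LocallyIntegrableOn f (Set.Ioi 0) := by
    have h1 : ∀ t ∈ Set.Ioi (0 : ℝ), ContinuousWithinAt (fun t : ℝ => (t : ℂ) ^ (φ : ℂ))
        (Set.Ioi 0) t := by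
      intro t ht
      exact (Complex.continuousAt_ofReal_cpow_const _ _ (Or.inr (ne_of_gt ht))).continuousWithinAt
    have h2 : LocallyIntegrableOn (fun t : ℝ => (t : ℂ) ^ (φ : ℂ)) (Set.Ioi 0) :=
      ContinuousOn.locallyIntegrableOn h1 measurableSet_Ioi
    intro t ht
    obtain ⟨U, hU, hU'⟩ := h2 t ht
    exact ⟨U, hU, hU'.indicator measurableSet_Ioc⟩
  -- f vanishes beyond 1, so any exponent exceeding Re u would serve.
  have htop : f =O[Filter.atTop] (fun t : ℝ => t ^ (-(u.re + 1))) := by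
    refine Asymptotics.IsBigO.of_bound 0 ?_
    filter_upwards [Filter.eventually_gt_atTop 1] with t ht
    rw [hf, Set.indicator_of_notMem (fun h => absurd h.2 (not_le.2 ht))]
    simp
  have hbot : f =O[nhdsWithin 0 (Set.Ioi 0)] (fun t : ℝ => t ^ (-(-φ))) := by
    refine Asymptotics.IsBigO.of_bound 1 ?_
    filter_upwards [self_mem_nhdsWithin] with t ht
    have ht : 0 < t := ht
    refine (norm_indicator_le_norm_self _ _).trans ?_
    rw [Complex.norm_cpow_eq_rpow_re_of_pos ht]
    simp [abs_of_pos (Real.rpow_pos_of_pos ht φ)]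
  obtain ⟨h1, h2⟩ := mellin_hasDerivAt_of_isBigO_rpow hloc htop (lt_add_one _) hbot
    (by linarith : -φ < u.re)
  have hne : u + φ ≠ 0 := by
    intro h0
    have := congrArg Complex.re h0
    simp at this
    linarith
  have h3 : HasDerivAt (mellin f) (-(1 / (u + φ) ^ 2)) u := by
    have : HasDerivAt (fun s : ℂ => (s + φ)⁻¹) (-1 / (u + φ) ^ 2) u :=
      ((hasDerivAt_id u).add_const (φ : ℂ)).inv hne
    rw [neg_div] at this
    refine this.congr_of_eventuallyEq ?_
    have ho : IsOpen {s : ℂ | 0 < s.re + φ} :=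
      isOpen_lt continuous_const (Complex.continuous_re.add continuous_const)
    filter_upwards [ho.mem_nhds h] with s hs
    rw [(hm s hs).2, one_div]
  -- At t = 1 the logarithm vanishes, so `Ioc` and the open interval give the same function
  -- everywhere.
  have heq : (fun y => (logKernel φ y : ℂ)) = fun t => (-1 : ℂ) • (Real.log t • f t) := by
    funext t
    unfold logKernel
    by_cases h : 0 < t ∧ t < 1
    · rw [if_pos h, hf, Set.indicator_of_mem (Set.mem_Ioc.2 ⟨h.1, h.2.le⟩), Complex.ofReal_mul,
        Complex.ofReal_cpow h.1.le]
      simp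
      ring
    · rw [if_neg h, hf]
      by_cases h1 : t ∈ Set.Ioc (0 : ℝ) 1
      · have : t = 1 := le_antisymm h1.2 (by by_contra h2; exact h ⟨h1.1, not_le.1 h2⟩)
        simp [this]
      · simp [Set.indicator_of_notMem h1]
  rw [heq]
  have := hasMellin_const_smul h1 (-1 : ℂ)
  rw [h2.unique h3] at this
  simpa using this

lemma integrable_inv_vertical_sq {δ : ℝ} (hδ : 0 < δ) :
    Integrable fun t : ℝ => ‖1 / ((δ : ℂ) + t * Complex.I) ^ 2‖ := by
  -- The constant is chosen so that (1 + δ⁻²)(δ² + t²) ≥ 1 + t².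
  refine (integrable_inv_one_add_sq.const_mul (1 + (δ ^ 2)⁻¹)).mono'
    (Measurable.aestronglyMeasurable (by fun_prop)) (Filter.Eventually.of_forall fun t => ?_)
  have hn : ‖(δ : ℂ) + t * Complex.I‖ ^ 2 = δ ^ 2 + t ^ 2 := by
    rw [← Complex.normSq_eq_norm_sq, Complex.normSq_add_mul_I]
  rw [norm_norm, norm_div, norm_pow, hn, norm_one, one_div]
  rw [inv_le_iff_one_le_mul₀ (by positivity)]
  have : (1 + (δ ^ 2)⁻¹) * (1 + t ^ 2)⁻¹ * (δ ^ 2 + t ^ 2) =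
      1 + (δ ^ 2 + (δ ^ 2)⁻¹ * t ^ 2) / (1 + t ^ 2) := by
    field_simp
    ring
  rw [this]
  have : 0 ≤ (δ ^ 2 + (δ ^ 2)⁻¹ * t ^ 2) / (1 + t ^ 2) := by positivity
  linarith

lemma integrable_norm_inv_sub_vertical_sq {φ σ : ℝ} (h : σ < φ) :
    Integrable fun t : ℝ => ‖1 / ((φ : ℂ) - (σ + t * Complex.I)) ^ 2‖ := by
  have := (integrable_inv_vertical_sq (sub_pos.2 h)).comp_neg
  refine this.congr (Filter.Eventually.of_forall fun t => ?_)
  simp only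
  congr 3
  push_cast
  ring

/-- Mellin-Barnes representation of the logarithmic kernel. -/
lemma logKernel_eq_integral {φ σ y : ℝ} (h : σ < φ) (hy : 0 < y) :
    (logKernel φ y : ℂ) = (1 / (2 * Real.pi) : ℂ) * ∫ t : ℝ,
      1 / ((φ : ℂ) - (σ + t * Complex.I)) ^ 2 * (y : ℂ) ^ ((σ : ℂ) + t * Complex.I) := by
  have hm : ∀ t : ℝ, mellin (fun y => (logKernel φ y : ℂ)) ((-σ : ℝ) + t * Complex.I) =
      1 / (((-σ : ℝ) + t * Complex.I) + φ) ^ 2 := fun t =>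
    (hasMellin_logKernel (by simp; linarith)).2
  have hv : Complex.VerticalIntegrable (mellin (fun y => (logKernel φ y : ℂ))) (-σ) := by
    unfold Complex.VerticalIntegrable
    simp_rw [hm]
    rw [← integrable_norm_iff (Measurable.aestronglyMeasurable (by fun_prop))]
    refine (integrable_inv_vertical_sq (sub_pos.2 h)).congr
      (Filter.Eventually.of_forall fun t => ?_)
    simp only
    congr 3
    push_cast
    ring
  have := mellinInv_mellin_eq (-σ) (fun y => (logKernel φ y : ℂ)) hy
    (hasMellin_logKernel (by simp; linarith)).1 hv
    (Complex.continuous_ofReal.continuousAt.comp (continuousAt_logKernel hy))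
  -- Mellin inversion uses y^(-s) on the line Re s = -σ; the reflection t ↦ -t turns this into y^s
  -- on Re s = σ.
  rw [← this, mellinInv, ← integral_neg_eq_self]
  simp_rw [hm]
  rw [Complex.real_smul]
  push_cast
  congr 1
  refine integral_congr_ae (Filter.Eventually.of_forall fun t => ?_)
  simp only [smul_eq_mul]
  rw [mul_comm]
  congr 2
  · ring
  · ring

/-! ### Generalized Gamma laws and their complex moments -/

/-- Density of the generalized Gamma law. -/
def genGammaPDF (a b c x : ℝ) : ℝ :=
  if 0 < x then c * x ^ (a * c - 1) / (b ^ (a * c) * Real.Gamma a) * Real.exp (-(x / b) ^ c) else 0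

/-- The generalized Gamma law. -/
def genGammaMeasure (a b c : ℝ) : Measure ℝ :=
  volume.withDensity fun x => ENNReal.ofReal (genGammaPDF a b c x)

instance (a b c : ℝ) : SFinite (genGammaMeasure a b c) := by
  unfold genGammaMeasure; infer_instance

@[fun_prop]
lemma measurable_genGammaPDF (a b c : ℝ) : Measurable (genGammaPDF a b c) := by
  unfold genGammaPDF
  exact Measurable.ite measurableSet_Ioi (by fun_prop) (by fun_prop)

lemma genGammaPDF_nonneg {a b c : ℝ} (ha : 0 < a) (hb : 0 < b) (hc : 0 < c) (x : ℝ) :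
    0 ≤ genGammaPDF a b c x := by
  unfold genGammaPDF
  split_ifs with h
  · have := Real.Gamma_pos_of_pos ha
    positivity
  · exact le_rfl

lemma ae_pos_genGammaMeasure (a b c : ℝ) : ∀ᵐ t ∂genGammaMeasure a b c, 0 < t := by
  unfold genGammaMeasure
  rw [ae_withDensity_iff (by fun_prop)]
  refine Filter.Eventually.of_forall fun x hx => ?_
  by_contra h
  simp [genGammaPDF, h] at hx

/-- Euler's integral after the substitution x = (t/b)^c. -/
lemma mellin_exp_neg_rpow {b c : ℝ} (hb : 0 < b) (hc : 0 < c) {s : ℂ} (hs : 0 < s.re) :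
    HasMellin (fun t : ℝ => (Real.exp (-(t / b) ^ c) : ℂ)) s
      ((b : ℂ) ^ s * ((c : ℂ)⁻¹ * Complex.Gamma (s / c))) := by
  have hs' : 0 < (s / c).re := by
    rw [Complex.div_ofReal_re]; positivity
  have h1 : MellinConvergent (fun x : ℝ => (Real.exp (-x) : ℂ)) (s / c) := by
    have := Complex.GammaIntegral_convergent hs'
    refine this.congr_fun (fun x _ => ?_) measurableSet_Ioi
    simp [mul_comm]
  have h2 := (MellinConvergent.comp_rpow hc.ne').2 h1
  have h3 := (MellinConvergent.comp_mul_left (inv_pos.2 hb)).2 h2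
  have hfun : (fun t : ℝ => (Real.exp (-(t / b) ^ c) : ℂ)) =
      fun t => (fun t : ℝ => (fun x : ℝ => (Real.exp (-x) : ℂ)) (t ^ c)) (b⁻¹ * t) := by
    funext t
    simp only
    rw [div_eq_inv_mul]
  rw [hfun]
  refine ⟨h3, ?_⟩
  rw [mellin_comp_mul_left (fun t : ℝ => (fun x : ℝ => (Real.exp (-x) : ℂ)) (t ^ c)) _
    (inv_pos.2 hb), mellin_comp_rpow (fun x : ℝ => (Real.exp (-x) : ℂ)),
    ← Complex.GammaIntegral_eq_mellin,
    ← Complex.Gamma_eq_integral hs', abs_of_pos hc, smul_eq_mul, Complex.real_smul]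
  congr 1
  · rw [Complex.ofReal_inv, Complex.inv_cpow, Complex.cpow_neg, inv_inv]
    rw [Complex.arg_ofReal_of_nonneg hb.le]
    exact Real.pi_ne_zero.symm
  · push_cast; rfl

/-- Moments of complex order of the generalized Gamma law. -/
lemma genGammaMeasure_moment {a b c : ℝ} (ha : 0 < a) (hb : 0 < b) (hc : 0 < c) {u : ℂ}
    (hu : 0 < a + u.re / c) :
    Integrable (fun t : ℝ => (t : ℂ) ^ u) (genGammaMeasure a b c) ∧
      ∫ t, (t : ℂ) ^ u ∂genGammaMeasure a b c =
        (b : ℂ) ^ u * Complex.Gamma (a + u / c) / Real.Gamma a := by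
  have hs : 0 < ((a * c : ℝ) + u).re := by
    have : (a * c + u.re) = (a + u.re / c) * c := by field_simp
    simp only [Complex.add_re, Complex.ofReal_re, this]
    positivity
  obtain ⟨h1, h2⟩ := mellin_exp_neg_rpow hb hc hs
  have hG := Real.Gamma_pos_of_pos ha
  set K : ℂ := ((c / (b ^ (a * c) * Real.Gamma a) : ℝ) : ℂ) with hK
  -- The factor t^(ac-1) of the density shifts the Mellin variable: the moment of order u is a
  -- Mellin transform at ac + u.
  have key : (fun t : ℝ => (ENNReal.ofReal (genGammaPDF a b c t)).toReal • (t : ℂ) ^ u) =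
      Set.indicator (Set.Ioi 0) fun t : ℝ =>
        K * ((t : ℂ) ^ (((a * c : ℝ) + u : ℂ) - 1) • (Real.exp (-(t / b) ^ c) : ℂ)) := by
    funext t
    rw [ENNReal.toReal_ofReal (genGammaPDF_nonneg ha hb hc t), genGammaPDF, Complex.real_smul]
    by_cases ht : 0 < t
    · rw [if_pos ht, Set.indicator_of_mem (Set.mem_Ioi.2 ht)]
      have : ((a * c : ℝ) + u : ℂ) - 1 = ((a * c - 1 : ℝ) : ℂ) + u := by push_cast; ring
      rw [this, Complex.cpow_add _ _ (by exact_mod_cast ht.ne'), ← Complex.ofReal_cpow ht.le, hK,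
        smul_eq_mul]
      push_cast
      ring
    · rw [if_neg ht, Set.indicator_of_notMem (by simpa using ht)]
      simp
  unfold genGammaMeasure
  constructor
  · rw [integrable_withDensity_iff_integrable_smul' (by fun_prop) (by simp), key,
      integrable_indicator_iff measurableSet_Ioi]
    exact Integrable.const_mul h1 K
  · rw [integral_withDensity_eq_integral_toReal_smul (by fun_prop) (by simp), key,
      integral_indicator measurableSet_Ioi, integral_const_mul]
    change K * mellin _ _ = _
    have hb' : (b : ℂ) ≠ 0 := by exact_mod_cast hb.ne'
    have hc' : (c : ℂ) ≠ 0 := by exact_mod_cast hc.ne'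
    have h4 : ((a * c : ℝ) + u : ℂ) / c = a + u / c := by push_cast; field_simp
    rw [h2, Complex.cpow_add _ _ hb', h4, hK, ← Complex.ofReal_cpow hb.le]
    have h5 : ((b ^ (a * c) : ℝ) : ℂ) ≠ 0 := by exact_mod_cast (Real.rpow_pos_of_pos hb _).ne'
    have h6 : ((Real.Gamma a : ℝ) : ℂ) ≠ 0 := by exact_mod_cast hG.ne'
    push_cast at h5 h6 ⊢
    field_simp

lemma integrable_rpow_genGammaMeasure {a b c : ℝ} (ha : 0 < a) (hb : 0 < b) (hc : 0 < c) {r : ℝ}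
    (hr : 0 < a + r / c) : Integrable (fun t : ℝ => t ^ r) (genGammaMeasure a b c) := by
  have := (genGammaMeasure_moment ha hb hc (u := (r : ℂ)) (by simpa using hr)).1.norm
  refine this.congr ?_
  filter_upwards [ae_pos_genGammaMeasure a b c] with t ht
  rw [Complex.norm_cpow_eq_rpow_re_of_pos ht, Complex.ofReal_re]

/-! ### Mellin-Barnes integrals as expectations -/

/-- Mellin-Barnes representation of the mean of the logarithmic kernel at the inverse of a product
of two independent generalized Gamma variables, along every admissible line. -/
lemma integral_logKernel_genGamma_prod {a₁ b₁ c₁ a₂ b₂ c₂ φ σ z : ℝ}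
    (ha₁ : 0 < a₁) (hb₁ : 0 < b₁) (hc₁ : 0 < c₁) (ha₂ : 0 < a₂) (hb₂ : 0 < b₂) (hc₂ : 0 < c₂)
    (hz : 0 < z) (hφ : σ < φ) (h₁ : 0 < a₁ - σ / c₁) (h₂ : 0 < a₂ - σ / c₂) :
    Integrable (fun p : ℝ × ℝ => logKernel φ (z / (p.1 * p.2)))
        ((genGammaMeasure a₁ b₁ c₁).prod (genGammaMeasure a₂ b₂ c₂)) ∧
      Integrable (fun t : ℝ =>
        Complex.Gamma (a₁ - (σ + t * Complex.I) / c₁) *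
          Complex.Gamma (a₂ - (σ + t * Complex.I) / c₂) / ((φ : ℂ) - (σ + t * Complex.I)) ^ 2 *
          ((z / (b₁ * b₂) : ℝ) : ℂ) ^ ((σ : ℂ) + t * Complex.I)) ∧
      (1 / (2 * Real.pi) : ℂ) * (∫ t : ℝ,
        Complex.Gamma (a₁ - (σ + t * Complex.I) / c₁) *
          Complex.Gamma (a₂ - (σ + t * Complex.I) / c₂) / ((φ : ℂ) - (σ + t * Complex.I)) ^ 2 *
          ((z / (b₁ * b₂) : ℝ) : ℂ) ^ ((σ : ℂ) + t * Complex.I)) =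
      ((Real.Gamma a₁ * Real.Gamma a₂ * ∫ p : ℝ × ℝ, logKernel φ (z / (p.1 * p.2))
        ∂((genGammaMeasure a₁ b₁ c₁).prod (genGammaMeasure a₂ b₂ c₂)) : ℝ) : ℂ) := by
  set μ := genGammaMeasure a₁ b₁ c₁ with hμ
  set ν := genGammaMeasure a₂ b₂ c₂ with hν
  set s : ℝ → ℂ := fun t => (σ : ℂ) + t * Complex.I with hs
  have hsm : Measurable s := by fun_prop
  have hsre : ∀ t, (s t).re = σ := fun t => by simp [hs]
  set F : ℝ → ℂ := fun t => Complex.Gamma (a₁ - s t / c₁) * Complex.Gamma (a₂ - s t / c₂) /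
    ((φ : ℂ) - s t) ^ 2 * ((z / (b₁ * b₂) : ℝ) : ℂ) ^ s t with hF
  have hpos : ∀ᵐ p ∂(μ.prod ν), 0 < p.1 ∧ 0 < p.2 := by
    rw [Measure.ae_prod_iff_ae_ae]
    · filter_upwards [ae_pos_genGammaMeasure a₁ b₁ c₁] with x hx
      filter_upwards [ae_pos_genGammaMeasure a₂ b₂ c₂] with y hy
      exact ⟨hx, hy⟩
    · exact (measurableSet_lt measurable_const measurable_fst).inter
        (measurableSet_lt measurable_const measurable_snd)
  set H : (ℝ × ℝ) × ℝ → ℂ := fun q =>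
    (1 / ((φ : ℂ) - s q.2) ^ 2 * (z : ℂ) ^ s q.2) *
      ((q.1.1 : ℂ) ^ (-s q.2) * (q.1.2 : ℂ) ^ (-s q.2)) with hH
  have hHm : Measurable H := by fun_prop
  -- The modulus of a power with positive base depends only on the real part of the exponent. So |H|
  -- splits into real moments of order -σ and the integrable |φ - s|⁻².
  have hHi : Integrable H ((μ.prod ν).prod volume) := by
    have e1 : Integrable (fun p : ℝ × ℝ => p.1 ^ (-σ) * p.2 ^ (-σ)) (μ.prod ν) :=
      (integrable_rpow_genGammaMeasure ha₁ hb₁ hc₁ (r := -σ)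
        (by rw [neg_div]; linarith)).mul_prod
      (integrable_rpow_genGammaMeasure ha₂ hb₂ hc₂ (r := -σ) (by rw [neg_div]; linarith))
    have e2 := e1.mul_prod ((integrable_norm_inv_sub_vertical_sq hφ).mul_const (z ^ σ))
    refine e2.mono' hHm.aestronglyMeasurable ?_
    have : ∀ᵐ q ∂((μ.prod ν).prod (volume : Measure ℝ)), 0 < q.1.1 ∧ 0 < q.1.2 :=
      Measure.quasiMeasurePreserving_fst.ae hpos
    filter_upwards [this] with q hq
    rw [hH]
    simp only [norm_mul]
    rw [Complex.norm_cpow_eq_rpow_re_of_pos hz, Complex.norm_cpow_eq_rpow_re_of_pos hq.1,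
      Complex.norm_cpow_eq_rpow_re_of_pos hq.2, Complex.neg_re, hsre]
    exact le_of_eq (by ring)
  have hleft : ∀ᵐ p ∂(μ.prod ν), (∫ t : ℝ, H (p, t)) =
      (2 * Real.pi : ℂ) * (logKernel φ (z / (p.1 * p.2)) : ℂ) := by
    filter_upwards [hpos] with p hp
    rw [logKernel_eq_integral hφ (by have := mul_pos hp.1 hp.2; positivity), ← mul_assoc,
      mul_one_div_cancel (by simp), one_mul]
    refine integral_congr_ae (Filter.Eventually.of_forall fun t => ?_)
    simp only [hH]
    rw [mul_assoc]
    congr 1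
    have : z / (p.1 * p.2) = z * (p.1⁻¹ * p.2⁻¹) := by field_simp
    rw [this, Complex.ofReal_mul, Complex.mul_cpow_ofReal_nonneg hz.le
        (by have := hp.1; have := hp.2; positivity),
      Complex.ofReal_mul, Complex.mul_cpow_ofReal_nonneg (inv_nonneg.2 hp.1.le)
        (inv_nonneg.2 hp.2.le), Complex.ofReal_inv, Complex.ofReal_inv,
      Complex.inv_cpow _ _ (by rw [Complex.arg_ofReal_of_nonneg hp.1.le]; exact Real.pi_ne_zero.symm),
      Complex.inv_cpow _ _ (by rw [Complex.arg_ofReal_of_nonneg hp.2.le]; exact Real.pi_ne_zero.symm),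
      ← Complex.cpow_neg, ← Complex.cpow_neg]
  have hright : ∀ t : ℝ, (∫ p, H (p, t) ∂(μ.prod ν)) =
      (Real.Gamma a₁ * Real.Gamma a₂ : ℂ)⁻¹ * F t := by
    intro t
    simp only [hH]
    rw [integral_const_mul, integral_prod_mul (fun x : ℝ => (x : ℂ) ^ (-s t))
      (fun x : ℝ => (x : ℂ) ^ (-s t)),
      (genGammaMeasure_moment ha₁ hb₁ hc₁ (u := -s t)
        (by rw [Complex.neg_re, hsre, neg_div]; linarith)).2,
      (genGammaMeasure_moment ha₂ hb₂ hc₂ (u := -s t)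
        (by rw [Complex.neg_re, hsre, neg_div]; linarith)).2]
    have : z / (b₁ * b₂) = z * (b₁⁻¹ * b₂⁻¹) := by field_simp
    simp only [hF]
    rw [this, Complex.ofReal_mul, Complex.mul_cpow_ofReal_nonneg hz.le (by positivity),
      Complex.ofReal_mul, Complex.mul_cpow_ofReal_nonneg (inv_nonneg.2 hb₁.le)
        (inv_nonneg.2 hb₂.le), Complex.ofReal_inv, Complex.ofReal_inv,
      Complex.inv_cpow _ _ (by rw [Complex.arg_ofReal_of_nonneg hb₁.le]; exact Real.pi_ne_zero.symm),
      Complex.inv_cpow _ _ (by rw [Complex.arg_ofReal_of_nonneg hb₂.le]; exact Real.pi_ne_zero.symm),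
      ← Complex.cpow_neg, ← Complex.cpow_neg, neg_div, neg_div, ← sub_eq_add_neg,
      ← sub_eq_add_neg, mul_inv]
    ring
  have hG : (Real.Gamma a₁ * Real.Gamma a₂ : ℂ) ≠ 0 := by
    exact_mod_cast (mul_pos (Real.Gamma_pos_of_pos ha₁) (Real.Gamma_pos_of_pos ha₂)).ne'
  have hpi : (2 * Real.pi : ℂ) ≠ 0 := by exact_mod_cast Real.two_pi_pos.ne'
  -- Both integrability claims are those of partial integrals of H, so no decay estimate for Gamma
  -- is needed; the identity is Fubini.
  refine ⟨?_, ?_, ?_⟩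
  · have e := (hHi.integral_prod_left.congr hleft).const_mul (2 * Real.pi : ℂ)⁻¹
    simp_rw [inv_mul_cancel_left₀ hpi] at e
    simpa using e.re
  · have e := hHi.integral_prod_right.const_mul (Real.Gamma a₁ * Real.Gamma a₂ : ℂ)
    simp_rw [hright, mul_inv_cancel_left₀ hG] at e
    exact e
  · have e := integral_integral_swap (f := fun p t => H (p, t)) hHi
    rw [integral_congr_ae hleft] at e
    simp_rw [hright] at e
    rw [integral_const_mul, integral_const_mul, integral_complex_ofReal] at e
    change _ * (∫ t, F t) = _
    rw [eq_comm, inv_mul_eq_iff_eq_mul₀ hG] at e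
    rw [e]
    push_cast
    field_simp

/-! ### Evaluation of the Fox and Meijer functions -/

lemma SeparatesPoles.of_pos_gamma_pair {κ φ w p₁ w₁ p₂ w₂ σ : ℝ}
    (h : SeparatesPoles 4 0 [(κ, w), (κ, w)] [(p₁, w₁), (φ, w), (p₂, w₂), (φ, w)] σ) :
    0 < p₁ - w₁ * σ ∧ 0 < φ - w * σ ∧ 0 < p₂ - w₂ * σ := by
  have := h.1
  simp only [List.take_succ_cons, List.take_zero, List.forall_mem_cons] at this
  exact ⟨this.1, this.2.1, this.2.2.1⟩

lemma separatesPoles_of_pos {κ φ w p₁ w₁ p₂ w₂ σ : ℝ}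
    (h₁ : 0 < p₁ - w₁ * σ) (h : 0 < φ - w * σ) (h₂ : 0 < p₂ - w₂ * σ) :
    SeparatesPoles 4 0 [(κ, w), (κ, w)] [(p₁, w₁), (φ, w), (p₂, w₂), (φ, w)] σ := by
  refine ⟨?_, by simp⟩
  simp only [List.take_succ_cons, List.take_zero, List.forall_mem_cons]
  exact ⟨h₁, h, h₂, h, by simp⟩

/-- The kernel reduces, by the functional equation of the Gamma function. -/
lemma foxHKernel_pair {φ w p₁ w₁ p₂ w₂ : ℝ} {s : ℂ} (h : 0 < φ - w * s.re) :
    foxHKernel 4 0 [(φ + 1, w), (φ + 1, w)] [(p₁, w₁), (φ, w), (p₂, w₂), (φ, w)] s =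
      Complex.Gamma (p₁ - w₁ * s) * Complex.Gamma (p₂ - w₂ * s) / ((φ : ℂ) - w * s) ^ 2 := by
  have hre : 0 < ((φ : ℂ) - w * s).re := by simpa using h
  have hne : (φ : ℂ) - w * s ≠ 0 := fun h0 => by simp [h0] at hre
  have hG := Complex.Gamma_ne_zero_of_re_pos hre
  have hadd : ((φ + 1 : ℝ) : ℂ) - w * s = ((φ : ℂ) - w * s) + 1 := by push_cast; ring
  simp only [foxHKernel, List.take_succ_cons, List.take_zero, List.map_cons, List.map_nil,
    List.prod_cons, List.prod_nil, List.drop_succ_cons, List.drop_zero, mul_one, one_mul, hadd,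
    Complex.Gamma_add_one _ hne]
  generalize (φ : ℂ) - w * s = u at hne hG ⊢
  field_simp

/-- A common value on all separating lines makes the arbitrary choice of line in `foxH` harmless. -/
lemma foxHWellDefined_of_forall {m n : ℕ} {a b : List (ℝ × ℝ)} {z : ℝ} {I : ℂ}
    (hex : ∃ σ, SeparatesPoles m n a b σ)
    (h : ∀ σ, SeparatesPoles m n a b σ →
      Integrable (foxHIntegrand m n a b z σ) ∧ foxHLine m n a b z σ = I) :
    FoxHWellDefined m n a b z ∧ foxH m n a b z = I := by
  have hI : foxH m n a b z = I := by
    rw [foxH, dif_pos hex]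
    exact (h _ hex.choose_spec).2
  exact ⟨⟨hex, fun σ hσ => ⟨(h σ hσ).1, by rw [(h σ hσ).2, hI]⟩⟩, hI⟩

/-- Common weight `1 / c` for the polynomial factor, weights `1 / c₁`, `1 / c₂` for the others. -/
lemma foxH_eq_integral_logKernel {a₁ b₁ c₁ a₂ b₂ c₂ c φ z : ℝ}
    (ha₁ : 0 < a₁) (hb₁ : 0 < b₁) (hc₁ : 0 < c₁) (ha₂ : 0 < a₂) (hb₂ : 0 < b₂) (hc₂ : 0 < c₂)
    (hc : 0 < c) (hφ : 0 < φ) (hz : 0 < z) :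
    FoxHWellDefined 4 0 [(φ / c + 1, 1 / c), (φ / c + 1, 1 / c)]
        [(a₁, 1 / c₁), (φ / c, 1 / c), (a₂, 1 / c₂), (φ / c, 1 / c)] (z / (b₁ * b₂)) ∧
      foxH 4 0 [(φ / c + 1, 1 / c), (φ / c + 1, 1 / c)]
        [(a₁, 1 / c₁), (φ / c, 1 / c), (a₂, 1 / c₂), (φ / c, 1 / c)] (z / (b₁ * b₂)) =
      ((c ^ 2 * (Real.Gamma a₁ * Real.Gamma a₂ * ∫ p : ℝ × ℝ, logKernel φ (z / (p.1 * p.2))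
        ∂((genGammaMeasure a₁ b₁ c₁).prod (genGammaMeasure a₂ b₂ c₂))) : ℝ) : ℂ) := by
  -- The line Re s = 0 always separates, since all lower parameters are positive.
  refine foxHWellDefined_of_forall ⟨0, separatesPoles_of_pos (by simpa) (by simp; positivity)
    (by simpa)⟩ fun σ hσ => ?_
  obtain ⟨h₁, h, h₂⟩ := hσ.of_pos_gamma_pair
  have hσφ : σ < φ := by
    have : φ / c - 1 / c * σ = (φ - σ) / c := by ring
    rw [this] at h
    have := (div_pos_iff_of_pos_right hc).1 h
    linarith
  obtain ⟨-, i1, i2⟩ := integral_logKernel_genGamma_prod ha₁ hb₁ hc₁ ha₂ hb₂ hc₂ hz hσφ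
    (by convert h₁ using 1; ring) (by convert h₂ using 1; ring)
  have hc' : (c : ℂ) ≠ 0 := by exact_mod_cast hc.ne'
  have hfun : foxHIntegrand 4 0 [(φ / c + 1, 1 / c), (φ / c + 1, 1 / c)]
      [(a₁, 1 / c₁), (φ / c, 1 / c), (a₂, 1 / c₂), (φ / c, 1 / c)] (z / (b₁ * b₂)) σ =
      fun t : ℝ => (c : ℂ) ^ 2 * (Complex.Gamma (a₁ - (σ + t * Complex.I) / c₁) *
          Complex.Gamma (a₂ - (σ + t * Complex.I) / c₂) / ((φ : ℂ) - (σ + t * Complex.I)) ^ 2 *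
          ((z / (b₁ * b₂) : ℝ) : ℂ) ^ ((σ : ℂ) + t * Complex.I)) := by
    funext t
    rw [foxHIntegrand, foxHKernel_pair (by simpa using h)]
    -- The polynomial factor is ((φ - s)/c)⁻², which is where c² comes from.
    have e : ((φ / c : ℝ) : ℂ) - ((1 / c : ℝ) : ℂ) * (σ + t * Complex.I) =
        (φ - (σ + t * Complex.I)) / c := by push_cast; ring
    have e1 : ∀ a c : ℝ, (a : ℂ) - ((1 / c : ℝ) : ℂ) * (σ + t * Complex.I) =
        a - (σ + t * Complex.I) / c := fun a c => by push_cast; ring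
    rw [e, e1, e1, div_pow, div_div_eq_mul_div]
    ring
  rw [foxHLine, hfun, integral_const_mul]
  refine ⟨i1.const_mul _, ?_⟩
  rw [mul_left_comm, i2]
  push_cast
  ring

/-- When all weights are equal, s ↦ cs carries the line Re s = σ to Re s = cσ and turns weights 1/c
into 1 and z into z^c. The change of measure 1/c reduces the factor c² to c. -/
lemma foxH_rpow_eq_integral_logKernel {a₁ b₁ a₂ b₂ c φ z : ℝ}
    (ha₁ : 0 < a₁) (hb₁ : 0 < b₁) (ha₂ : 0 < a₂) (hb₂ : 0 < b₂)
    (hc : 0 < c) (hφ : 0 < φ) (hz : 0 < z) :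
    FoxHWellDefined 4 0 [(φ / c + 1, 1), (φ / c + 1, 1)]
        [(a₁, 1), (φ / c, 1), (a₂, 1), (φ / c, 1)] ((z / (b₁ * b₂)) ^ c) ∧
      foxH 4 0 [(φ / c + 1, 1), (φ / c + 1, 1)]
        [(a₁, 1), (φ / c, 1), (a₂, 1), (φ / c, 1)] ((z / (b₁ * b₂)) ^ c) =
      ((c * (Real.Gamma a₁ * Real.Gamma a₂ * ∫ p : ℝ × ℝ, logKernel φ (z / (p.1 * p.2))
        ∂((genGammaMeasure a₁ b₁ c).prod (genGammaMeasure a₂ b₂ c))) : ℝ) : ℂ) := by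
  refine foxHWellDefined_of_forall ⟨0, separatesPoles_of_pos (by simpa) (by simp; positivity)
    (by simpa)⟩ fun σ hσ => ?_
  obtain ⟨h₁, h, h₂⟩ := hσ.of_pos_gamma_pair
  have hcσ : c * σ / c = σ := by field_simp
  have hσφ : c * σ < φ := by
    have : φ / c - 1 * σ = (φ - c * σ) / c := by field_simp
    rw [this] at h
    have := (div_pos_iff_of_pos_right hc).1 h
    linarith
  obtain ⟨-, i1, i2⟩ := integral_logKernel_genGamma_prod ha₁ hb₁ hc ha₂ hb₂ hc hz hσφ
    (by rw [hcσ]; linarith) (by rw [hcσ]; linarith)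
  have hc' : (c : ℂ) ≠ 0 := by exact_mod_cast hc.ne'
  set F : ℝ → ℂ := fun t : ℝ => Complex.Gamma (a₁ - ((c * σ : ℝ) + t * Complex.I) / c) *
          Complex.Gamma (a₂ - ((c * σ : ℝ) + t * Complex.I) / c) /
            ((φ : ℂ) - ((c * σ : ℝ) + t * Complex.I)) ^ 2 *
          ((z / (b₁ * b₂) : ℝ) : ℂ) ^ (((c * σ : ℝ) : ℂ) + t * Complex.I) with hF
  have hfun : foxHIntegrand 4 0 [(φ / c + 1, 1), (φ / c + 1, 1)]
      [(a₁, 1), (φ / c, 1), (a₂, 1), (φ / c, 1)] ((z / (b₁ * b₂)) ^ c) σ =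
      fun t : ℝ => (c : ℂ) ^ 2 * F (c * t) := by
    funext t
    have e0 : ((c * σ : ℝ) : ℂ) + ((c * t : ℝ) : ℂ) * Complex.I = c * (σ + t * Complex.I) := by
      push_cast; ring
    rw [foxHIntegrand, foxHKernel_pair (by simpa using h), hF]
    simp only [e0]
    rw [mul_div_cancel_left₀ _ hc']
    have e : ((φ / c : ℝ) : ℂ) - ((1 : ℝ) : ℂ) * (σ + t * Complex.I) =
        (φ - c * (σ + t * Complex.I)) / c := by push_cast; field_simp
    have hz' : 0 ≤ z / (b₁ * b₂) := by positivity
    rw [e, div_pow, div_div_eq_mul_div, Complex.ofReal_one, one_mul,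
      Complex.ofReal_cpow hz', Complex.cpow_mul_ofReal_nonneg hz', Complex.ofReal_cpow hz']
    ring
  rw [foxHLine, hfun, integral_const_mul, Measure.integral_comp_mul_left, abs_inv, abs_of_pos hc]
  refine ⟨(i1.comp_mul_left' hc.ne').const_mul _, ?_⟩
  rw [Complex.real_smul, mul_left_comm, mul_left_comm (1 / (2 * (Real.pi : ℂ))), i2]
  push_cast
  field_simp

/-! ### Multiplicative convolutions and power laws -/

/-- Density of a product of a positive variable with an independent variable having a density. -/
lemma mconv_withDensity_eq_of_ae_pos {ρ : Measure ℝ} [SFinite ρ] (hρ : ∀ᵐ t ∂ρ, 0 < t)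
    {p : ℝ → ENNReal} (hp : Measurable p) :
    ρ ∗ₘ volume.withDensity p =
      volume.withDensity fun x => ∫⁻ t, ENNReal.ofReal t⁻¹ * p (x / t) ∂ρ := by
  have hm : Measurable fun q : ℝ × ℝ => ENNReal.ofReal q.2⁻¹ * p (q.1 / q.2) := by fun_prop
  refine Measure.ext_of_lintegral _ fun g hg => ?_
  rw [Measure.lintegral_mconv hg,
    lintegral_withDensity_eq_lintegral_mul _ hm.lintegral_prod_right' hg]
  simp only [Pi.mul_apply]
  have h1 : ∀ x, (∫⁻ t, ENNReal.ofReal t⁻¹ * p (x / t) ∂ρ) * g x =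
      ∫⁻ t, ENNReal.ofReal t⁻¹ * p (x / t) * g x ∂ρ := fun x =>
    (lintegral_mul_const _ (by fun_prop)).symm
  simp_rw [h1]
  refine Eq.trans ?_ (lintegral_lintegral_swap (μ := ρ) (ν := volume)
    (f := fun t x => ENNReal.ofReal t⁻¹ * p (x / t) * g x) (by fun_prop))
  refine lintegral_congr_ae ?_
  filter_upwards [hρ] with t ht
  have hF : Measurable fun x => p (x / t) * g x := by fun_prop
  rw [lintegral_withDensity_eq_lintegral_mul _ hp (by fun_prop)]
  -- Substitution x = ty for fixed t > 0, whose Jacobian gives the factor t⁻¹.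
  have h2 := congrArg (fun m => ∫⁻ x, p (x / t) * g x ∂m) (Real.map_volume_mul_left ht.ne')
  simp only [lintegral_smul_measure, abs_of_pos (inv_pos.2 ht)] at h2
  rw [lintegral_map hF (by fun_prop), smul_eq_mul, ← lintegral_const_mul _ hF] at h2
  simp_rw [mul_assoc]
  rw [← h2]
  refine lintegral_congr fun y => ?_
  simp [mul_div_cancel_left₀ _ ht.ne']

lemma mconv_mconv_mconv_comm (μ₁ μ₂ μ₃ μ₄ : Measure ℝ) [SFinite μ₁] [SFinite μ₂] [SFinite μ₃]
    [SFinite μ₄] : (μ₁ ∗ₘ μ₂) ∗ₘ (μ₃ ∗ₘ μ₄) = (μ₁ ∗ₘ μ₃) ∗ₘ (μ₂ ∗ₘ μ₄) := by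
  rw [Measure.mconv_assoc, ← Measure.mconv_assoc μ₂, Measure.mconv_comm μ₂ μ₃,
    Measure.mconv_assoc μ₃, ← Measure.mconv_assoc μ₁]

/-- Density of a power `u ^ (1 / φ)` of a uniform variable. -/
def powerPDF (φ y : ℝ) : ℝ := if 0 < y ∧ y < 1 then φ * y ^ (φ - 1) else 0

/-- Law of a power `u ^ (1 / φ)` of a uniform variable. -/
def powerMeasure (φ : ℝ) : Measure ℝ := volume.withDensity fun y => ENNReal.ofReal (powerPDF φ y)

/-- Density of the product of two independent variables with law `powerMeasure φ`. -/
def logPowerPDF (φ y : ℝ) : ℝ := if 0 < y ∧ y < 1 then φ ^ 2 * (y ^ (φ - 1) * -Real.log y) else 0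

instance (φ : ℝ) : SFinite (powerMeasure φ) := by
  unfold powerMeasure; infer_instance

@[fun_prop]
lemma measurable_powerPDF (φ : ℝ) : Measurable (powerPDF φ) :=
  Measurable.ite (measurableSet_Ioo (a := (0 : ℝ)) (b := 1)) (by fun_prop) (by fun_prop)

@[fun_prop]
lemma measurable_logPowerPDF (φ : ℝ) : Measurable (logPowerPDF φ) :=
  Measurable.ite (measurableSet_Ioo (a := (0 : ℝ)) (b := 1)) (by fun_prop) (by fun_prop)

lemma ae_pos_powerMeasure (φ : ℝ) : ∀ᵐ t ∂powerMeasure φ, 0 < t := by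
  unfold powerMeasure
  rw [ae_withDensity_iff (by fun_prop)]
  refine Filter.Eventually.of_forall fun x hx => ?_
  by_contra h
  simp [powerPDF, h] at hx

/-- The powers of t combine to φ² x^(φ-1) t⁻¹ on x < t < 1, and ∫ dt/t over that interval is
log(1/x). -/
lemma powerMeasure_mconv_self {φ : ℝ} (hφ : 0 < φ) :
    powerMeasure φ ∗ₘ powerMeasure φ =
      volume.withDensity fun y => ENNReal.ofReal (logPowerPDF φ y) := by
  conv_lhs => enter [2]; unfold powerMeasure
  rw [mconv_withDensity_eq_of_ae_pos (ae_pos_powerMeasure φ) (by fun_prop)]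
  congr 1
  funext x
  rw [powerMeasure, lintegral_withDensity_eq_lintegral_mul _ (by fun_prop) (by fun_prop)]
  simp only [Pi.mul_apply]
  unfold logPowerPDF
  by_cases hx : 0 < x ∧ x < 1
  · rw [if_pos hx]
    have h1 : ∀ t, ENNReal.ofReal (powerPDF φ t) *
        (ENNReal.ofReal t⁻¹ * ENNReal.ofReal (powerPDF φ (x / t))) =
        (Set.Ioo x 1).indicator
          (fun t => ENNReal.ofReal (φ ^ 2 * x ^ (φ - 1) * t⁻¹)) t := by
      intro t
      unfold powerPDF
      by_cases ht : t ∈ Set.Ioo x 1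
      · have ht0 : 0 < t := hx.1.trans ht.1
        have hxt : 0 < x / t ∧ x / t < 1 := ⟨div_pos hx.1 ht0, (div_lt_one ht0).2 ht.1⟩
        rw [Set.indicator_of_mem ht, if_pos ⟨ht0, ht.2⟩, if_pos hxt,
          ← ENNReal.ofReal_mul (by positivity), ← ENNReal.ofReal_mul (by positivity),
          Real.div_rpow hx.1.le ht0.le]
        congr 1
        have := (Real.rpow_pos_of_pos ht0 (φ - 1)).ne'
        field_simp
      · rw [Set.indicator_of_notMem ht]
        by_cases h0 : 0 < t ∧ t < 1
        · have : ¬ (0 < x / t ∧ x / t < 1) := fun h => ht ⟨(div_lt_one h0.1).1 h.2, h0.2⟩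
          rw [if_neg this]
          simp
        · rw [if_neg h0]
          simp
    simp_rw [h1]
    rw [lintegral_indicator measurableSet_Ioo, restrict_Ioo_eq_restrict_Ioc,
      ← ofReal_integral_eq_lintegral_ofReal, ← intervalIntegral.integral_of_le hx.2.le,
      intervalIntegral.integral_const_mul, integral_inv_of_pos hx.1 one_pos, one_div, Real.log_inv]
    · rw [mul_assoc]
    · have : IntervalIntegrable (fun t : ℝ => t⁻¹) volume x 1 :=
        (continuousOn_inv₀.mono fun t ht => by
          rw [Set.uIcc_of_le hx.2.le] at ht
          exact (hx.1.trans_le ht.1).ne').intervalIntegrable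
      exact ((intervalIntegrable_iff_integrableOn_Ioc_of_le hx.2.le).1 this).const_mul _
    · filter_upwards [ae_restrict_mem measurableSet_Ioc] with t ht
      have := hx.1
      have := hx.1.trans ht.1
      simp only [Pi.zero_apply]
      positivity
  · rw [if_neg hx, ENNReal.ofReal_zero, lintegral_eq_zero_iff (by fun_prop)]
    refine Filter.Eventually.of_forall fun t => ?_
    simp only [powerPDF, Pi.zero_apply]
    by_cases h0 : 0 < t ∧ t < 1
    · have : ¬ (0 < x / t ∧ x / t < 1) := fun h =>
        hx ⟨(div_pos_iff_of_pos_right h0.1).1 h.1, ((div_lt_one h0.1).1 h.2).trans h0.2⟩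
      rw [if_neg this]
      simp
    · rw [if_neg h0]
      simp

/-! ### The pointing loss as a power of a uniform variable -/

lemma image_exp_neg_sq {k : ℝ} (hk : 0 < k) :
    (fun r : ℝ => Real.exp (-(k * r ^ 2))) '' Set.Ioi 0 = Set.Ioo 0 1 := by
  ext y
  constructor
  · rintro ⟨r, hr, rfl⟩
    have hr : 0 < r := hr
    have : 0 < k * r ^ 2 := by positivity
    exact ⟨Real.exp_pos _, (Real.exp_lt_exp.2 (neg_lt_zero.2 this)).trans_eq Real.exp_zero⟩
  · rintro ⟨h0, h1⟩
    have hl := Real.log_neg h0 h1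
    have hp : 0 < -Real.log y / k := div_pos (by linarith) hk
    refine ⟨√(-Real.log y / k), Real.sqrt_pos.2 hp, ?_⟩
    simp only
    rw [Real.sq_sqrt hp.le, mul_div_cancel₀ _ hk.ne', neg_neg, Real.exp_log h0]

/-- A squared planar Gaussian radius is exponentially distributed. -/
lemma hasLaw_exp_neg_radius_sq {W σs : ℝ} (hW : 0 < W) (hσ : 0 < σs) :
    HasLaw (fun u : ℝ × ℝ => Real.exp (-(2 * √(u.1 ^ 2 + u.2 ^ 2) ^ 2) / W ^ 2))
      (powerMeasure ((W / (2 * σs)) ^ 2)) (jitterMeasure σs) := by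
  set φ := (W / (2 * σs)) ^ 2 with hφ
  refine ⟨by fun_prop, ?_⟩
  have hv : (σs ^ 2).toNNReal ≠ 0 := by
    simp only [ne_eq, Real.toNNReal_eq_zero, not_le]; positivity
  refine Measure.ext_of_lintegral _ fun g hg => ?_
  rw [lintegral_map hg (by fun_prop), jitterMeasure, gaussianReal_of_var_ne_zero _ hv,
    prod_withDensity (by fun_prop) (by fun_prop), ← Measure.volume_eq_prod,
    lintegral_withDensity_eq_lintegral_mul _ (by fun_prop) (by fun_prop),
    ← lintegral_comp_polarCoord_symm, polarCoord_target, Measure.volume_eq_prod]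
  simp only [Pi.mul_apply, polarCoord_symm_apply]
  set k := 2 / W ^ 2 with hk
  have hkp : 0 < k := by positivity
  have h1 : ∀ r θ : ℝ, ENNReal.ofReal r • (gaussianPDF 0 (σs ^ 2).toNNReal (r * Real.cos θ) *
      gaussianPDF 0 (σs ^ 2).toNNReal (r * Real.sin θ) *
      g (Real.exp (-(2 * √((r * Real.cos θ) ^ 2 + (r * Real.sin θ) ^ 2) ^ 2) / W ^ 2))) =
      ENNReal.ofReal r * (ENNReal.ofReal ((2 * Real.pi * σs ^ 2)⁻¹ *
        Real.exp (-(r ^ 2 / (2 * σs ^ 2)))) * g (Real.exp (-(k * r ^ 2)))) := by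
    intro r θ
    have hr : (r * Real.cos θ) ^ 2 + (r * Real.sin θ) ^ 2 = r ^ 2 := by
      rw [mul_pow, mul_pow, ← mul_add, Real.cos_sq_add_sin_sq, mul_one]
    rw [hr, Real.sq_sqrt (sq_nonneg r), smul_eq_mul, gaussianPDF, gaussianPDF,
      ← ENNReal.ofReal_mul (gaussianPDFReal_nonneg _ _ _), gaussianPDFReal, gaussianPDFReal,
      Real.coe_toNNReal _ (sq_nonneg σs), mul_mul_mul_comm, ← Real.exp_add, ← mul_inv,
      Real.mul_self_sqrt (by positivity), sub_zero, sub_zero, ← add_div, ← neg_add, hr, neg_div,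
      neg_div, hk, div_mul_eq_mul_div]
  rw [setLIntegral_prod _ (by fun_prop)]
  -- The integrand no longer depends on θ, so the angular integral is the factor 2π; the
  -- substitution y = exp(-kr²) remains.
  simp only [h1, lintegral_const, Measure.restrict_apply_univ, Real.volume_Ioo]
  have h2 : (fun y => ENNReal.ofReal (powerPDF φ y) * g y) =
      (Set.Ioo 0 1).indicator fun y => ENNReal.ofReal (φ * y ^ (φ - 1)) * g y := by
    funext y
    unfold powerPDF
    by_cases hy : 0 < y ∧ y < 1
    · rw [if_pos hy, Set.indicator_of_mem (Set.mem_Ioo.2 hy)]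
    · rw [if_neg hy, Set.indicator_of_notMem (mt Set.mem_Ioo.1 hy)]
      simp
  rw [powerMeasure, lintegral_withDensity_eq_lintegral_mul _ (by fun_prop) hg]
  change _ = ∫⁻ y, ENNReal.ofReal (powerPDF φ y) * g y
  rw [h2, lintegral_indicator measurableSet_Ioo, ← image_exp_neg_sq hkp,
    lintegral_image_eq_lintegral_abs_deriv_mul measurableSet_Ioi
      (f' := fun r => Real.exp (-(k * r ^ 2)) * (-(k * (2 * r)))) _ _]
  · refine setLIntegral_congr_fun measurableSet_Ioi fun r hr => ?_
    have hr : 0 < r := hr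
    have hpi := Real.pi_pos
    rw [← mul_assoc, ← mul_assoc, mul_right_comm, ← ENNReal.ofReal_mul hr.le,
      ← ENNReal.ofReal_mul (by positivity), ← ENNReal.ofReal_mul (by positivity)]
    congr 2
    rw [mul_neg, abs_neg, abs_of_pos (by positivity), ← Real.exp_mul]
    have e : Real.exp (-(k * r ^ 2)) * (k * (2 * r)) * (φ * Real.exp (-(k * r ^ 2) * (φ - 1))) =
        k * (2 * r) * φ * Real.exp (-(k * r ^ 2) * φ) := by
      have : -(k * r ^ 2) * φ = -(k * r ^ 2) + -(k * r ^ 2) * (φ - 1) := by ring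
      rw [this, Real.exp_add]
      ring
    rw [e]
    -- This fixes the exponent: exp(-r²/(2σs²)) = y^φ for y = exp(-kr²).
    have e2 : k * φ = (2 * σs ^ 2)⁻¹ := by
      rw [hk, hφ]; field_simp
    have e3 : -(k * r ^ 2) * φ = -(r ^ 2 / (2 * σs ^ 2)) := by
      rw [div_eq_mul_inv, ← e2]; ring
    have e4 : k * (2 * r) * φ = 2 * r * (2 * σs ^ 2)⁻¹ := by rw [← e2]; ring
    rw [e3, e4]
    field_simp
    ring
  · intro r _
    have : HasDerivAt (fun r : ℝ => -(k * r ^ 2)) (-(k * (2 * r))) r :=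
      ((hasDerivAt_pow 2 r).const_mul k).fun_neg.congr_deriv (by simp)
    exact this.exp.hasDerivWithinAt
  · intro r hr s hs h
    have hr : 0 < r := hr
    have hs : 0 < s := hs
    have h := Real.exp_injective h
    have : r ^ 2 = s ^ 2 := mul_left_cancel₀ hkp.ne' (neg_injective h)
    exact (pow_left_inj₀ hr.le hs.le two_ne_zero).1 this

/-! ### The turbulence mixture and positivity of the constants -/

/-- The exponential law is the generalized Gamma law with a = c = 1 and scale β, so one moment
formula serves every pair of components. -/
lemma eggMeasure_eq_mixture {α β a b c : ℝ} (hα : α ∈ Set.Icc (0 : ℝ) 1) (hβ : 0 < β)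
    (ha : 0 < a) (hb : 0 < b) (hc : 0 < c) :
    eggMeasure α β a b c = ENNReal.ofReal α • genGammaMeasure 1 β 1 +
      ENNReal.ofReal (1 - α) • genGammaMeasure a b c := by
  have h1 : 0 ≤ 1 - α := by linarith [hα.2]
  unfold genGammaMeasure eggMeasure
  rw [← withDensity_smul _ (by fun_prop), ← withDensity_smul _ (by fun_prop),
    ← withDensity_add_left (by fun_prop)]
  congr 1
  funext x
  simp only [Pi.add_apply, Pi.smul_apply, smul_eq_mul]
  rw [← ENNReal.ofReal_mul hα.1, ← ENNReal.ofReal_mul h1,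
    ← ENNReal.ofReal_add (mul_nonneg hα.1 (genGammaPDF_nonneg one_pos hβ one_pos x))
      (mul_nonneg h1 (genGammaPDF_nonneg ha hb hc x))]
  congr 1
  unfold eggPDF genGammaPDF
  split_ifs
  · simp only [mul_one, sub_self, Real.rpow_zero, Real.rpow_one, Real.Gamma_one, neg_div]
    ring
  · simp

lemma ae_pos_eggMeasure (α β a b c : ℝ) : ∀ᵐ t ∂eggMeasure α β a b c, 0 < t := by
  unfold eggMeasure
  have : Measurable (eggPDF α β a b c) := by
    unfold eggPDF
    exact Measurable.ite measurableSet_Ioi (by fun_prop) (by fun_prop)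
  rw [ae_withDensity_iff (by fun_prop)]
  refine Filter.Eventually.of_forall fun x hx => ?_
  by_contra h
  simp [eggPDF, h] at hx

/-- Expansion of a symmetric double integral against a mixture of two measures. -/
lemma integral_prod_self_mixture {μ ν : Measure ℝ} [SFinite μ] [SFinite ν] {F : ℝ × ℝ → ℝ}
    (hsymm : ∀ p, F p.swap = F p) {s t : ENNReal} (hs : s ≠ ⊤) (ht : t ≠ ⊤)
    (h₁ : Integrable F (μ.prod μ)) (h₂ : Integrable F (ν.prod μ)) (h₃ : Integrable F (ν.prod ν)) :
    Integrable F ((s • μ + t • ν).prod (s • μ + t • ν)) ∧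
      ∫ p, F p ∂((s • μ + t • ν).prod (s • μ + t • ν)) =
      s.toReal ^ 2 * ∫ p, F p ∂(μ.prod μ) + 2 * s.toReal * t.toReal * ∫ p, F p ∂(ν.prod μ) +
        t.toReal ^ 2 * ∫ p, F p ∂(ν.prod ν) := by
  have h₂' : Integrable F (μ.prod ν) :=
    h₂.swap.congr (Filter.Eventually.of_forall hsymm)
  have e : ∫ p, F p ∂(μ.prod ν) = ∫ p, F p ∂(ν.prod μ) := by
    rw [← integral_prod_swap]
    simp_rw [hsymm]
  have hM : (s • μ + t • ν).prod (s • μ + t • ν) =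
      ((s * s) • μ.prod μ + (s * t) • ν.prod μ) + ((s * t) • μ.prod ν + (t * t) • ν.prod ν) := by
    rw [Measure.prod_add, Measure.add_prod, Measure.add_prod, Measure.prod_smul_left,
      Measure.prod_smul_left, Measure.prod_smul_left, Measure.prod_smul_left,
      Measure.prod_smul_right, Measure.prod_smul_right, Measure.prod_smul_right,
      Measure.prod_smul_right, smul_smul, smul_smul, smul_smul, smul_smul, mul_comm t s]
  have i₁ := h₁.smul_measure (ENNReal.mul_ne_top hs hs)
  have i₂ := h₂.smul_measure (ENNReal.mul_ne_top hs ht)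
  have i₂' := h₂'.smul_measure (ENNReal.mul_ne_top hs ht)
  have i₃ := h₃.smul_measure (ENNReal.mul_ne_top ht ht)
  rw [hM]
  refine ⟨(i₁.add_measure i₂).add_measure (i₂'.add_measure i₃), ?_⟩
  rw [integral_add_measure (i₁.add_measure i₂) (i₂'.add_measure i₃), integral_add_measure i₁ i₂,
    integral_add_measure i₂' i₃]
  simp only [integral_smul_measure, ENNReal.toReal_mul, e, smul_eq_mul]
  ring

lemma erf_pos {x : ℝ} (hx : 0 < x) : 0 < erf x := by
  have : 0 < ∫ t in (0 : ℝ)..x, Real.exp (-t ^ 2) :=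
    intervalIntegral.intervalIntegral_pos_of_pos
      ((by fun_prop : Continuous fun t : ℝ => Real.exp (-t ^ 2)).intervalIntegrable _ _)
      (fun t => Real.exp_pos _) hx
  have hpi := Real.pi_pos
  unfold erf
  positivity

lemma apertureRatio_pos {ra ωb : ℝ} (hra : 0 < ra) (hωb : 0 < ωb) : 0 < apertureRatio ra ωb := by
  have hpi := Real.pi_pos
  unfold apertureRatio
  positivity

lemma maxCollectedPower_pos {ra ωb : ℝ} (hra : 0 < ra) (hωb : 0 < ωb) :
    0 < maxCollectedPower ra ωb :=
  pow_pos (erf_pos (apertureRatio_pos hra hωb)) 2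

lemma equivBeamWidth_pos {ra ωb : ℝ} (hra : 0 < ra) (hωb : 0 < ωb) :
    0 < equivBeamWidth ra ωb := by
  have hpi := Real.pi_pos
  have h1 := apertureRatio_pos hra hωb
  have h2 := erf_pos h1
  unfold equivBeamWidth
  positivity

/-! ### Law of the composite gain -/

/-- From t⁻¹ (x/t)^(φ-1) = x⁻¹ (x/t)^φ: the factor x⁻¹ leaves the expectation and only the kernel
stays inside. -/
lemma inv_mul_logPowerPDF_div {φ x t : ℝ} (hx : 0 < x) (ht : 0 < t) :
    t⁻¹ * logPowerPDF φ (x / t) = x⁻¹ * (φ ^ 2 * logKernel φ (x / t)) := by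
  unfold logPowerPDF logKernel
  have hxt : 0 < x / t := by positivity
  split_ifs
  · rw [Real.rpow_sub_one hxt.ne']
    field_simp
  · simp

/-- Density of `K T₁ T₂ V₁ V₂`, for independent `T₁, T₂` of law `τ` and `V₁, V₂` of law
`powerMeasure φ`. -/
def compositePDF (τ : Measure ℝ) (φ K x : ℝ) : ℝ :=
  if 0 < x then
    x⁻¹ * (φ ^ 2 * ∫ p : ℝ × ℝ, logKernel φ (x / K / (p.1 * p.2)) ∂(τ.prod τ))
  else 0

lemma measurable_compositePDF (τ : Measure ℝ) [SFinite τ] (φ K : ℝ) :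
    Measurable (compositePDF τ φ K) := by
  have h : StronglyMeasurable fun x : ℝ =>
      ∫ p : ℝ × ℝ, logKernel φ (x / K / (p.1 * p.2)) ∂(τ.prod τ) :=
    StronglyMeasurable.integral_prod_right
      (f := fun (x : ℝ) (p : ℝ × ℝ) => logKernel φ (x / K / (p.1 * p.2)))
      (Measurable.stronglyMeasurable (by fun_prop))
  have h' := h.measurable
  exact Measurable.ite measurableSet_Ioi (by fun_prop) (by fun_prop)

lemma compositePDF_nonneg (τ : Measure ℝ) (φ K x : ℝ) : 0 ≤ compositePDF τ φ K x := by
  unfold compositePDF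
  split_ifs with h
  · have : 0 ≤ ∫ p : ℝ × ℝ, logKernel φ (x / K / (p.1 * p.2)) ∂(τ.prod τ) :=
      integral_nonneg fun p => logKernel_nonneg φ _
    positivity
  · exact le_rfl

/-- Conditioning on K T₁T₂ leaves the density of V₁V₂, rescaled. Integrability of the kernel is what
turns the resulting `lintegral` into a real expectation. -/
lemma dirac_mconv_mconv_powerMeasure {τ : Measure ℝ} [SFinite τ] (hτ : ∀ᵐ t ∂τ, 0 < t)
    {φ K : ℝ} (hφ : 0 < φ) (hK : 0 < K)
    (hint : ∀ x, 0 < x →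
      Integrable (fun p : ℝ × ℝ => logKernel φ (x / K / (p.1 * p.2))) (τ.prod τ)) :
    (Measure.dirac K ∗ₘ (τ ∗ₘ τ)) ∗ₘ (powerMeasure φ ∗ₘ powerMeasure φ) =
      volume.withDensity fun x => ENNReal.ofReal (compositePDF τ φ K x) := by
  have hρ : Measure.dirac K ∗ₘ (τ ∗ₘ τ) =
      (τ.prod τ).map fun p : ℝ × ℝ => K * (p.1 * p.2) := by
    rw [Measure.dirac_mconv, Measure.mconv, Measure.map_map (by fun_prop) (by fun_prop)]
    rfl
  have hpos : ∀ᵐ p ∂(τ.prod τ), 0 < K * (p.1 * p.2) := by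
    rw [Measure.ae_prod_iff_ae_ae (measurableSet_lt (by fun_prop) (by fun_prop))]
    filter_upwards [hτ] with x hx
    filter_upwards [hτ] with y hy
    positivity
  have hpos' : ∀ᵐ t ∂(Measure.dirac K ∗ₘ (τ ∗ₘ τ)), 0 < t := by
    rw [hρ, ae_map_iff (by fun_prop) measurableSet_Ioi]
    exact hpos
  rw [powerMeasure_mconv_self hφ, mconv_withDensity_eq_of_ae_pos hpos' (by fun_prop)]
  congr 1
  funext x
  rw [hρ, lintegral_map (by fun_prop) (by fun_prop)]
  unfold compositePDF
  split_ifs with hx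
  · rw [← integral_const_mul, ← integral_const_mul, ofReal_integral_eq_lintegral_ofReal]
    · refine lintegral_congr_ae ?_
      filter_upwards [hpos] with p hp
      rw [← ENNReal.ofReal_mul (inv_nonneg.2 hp.le), inv_mul_logPowerPDF_div hx hp, div_div]
    · exact ((hint x hx).const_mul _).const_mul _
    · refine Filter.Eventually.of_forall fun p => ?_
      have := logKernel_nonneg φ (x / K / (p.1 * p.2))
      simp only [Pi.zero_apply]
      positivity
  · rw [ENNReal.ofReal_zero, lintegral_eq_zero_iff (by fun_prop)]
    filter_upwards [hpos] with p hp
    have : ¬ (0 < x / (K * (p.1 * p.2)) ∧ x / (K * (p.1 * p.2)) < 1) := fun h =>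
      hx ((div_pos_iff_of_pos_right hp).1 h.1)
    simp [logPowerPDF, this]

lemma hasLaw_channelGain {Ω : Type*} [MeasurableSpace Ω] {P : Measure Ω} [IsProbabilityMeasure P]
    {hAtt ra ωb σs : ℝ} (hra : 0 < ra) (hωb : 0 < ωb) (hσs : 0 < σs) {τ : Measure ℝ}
    {T : Ω → ℝ} {U : Ω → ℝ × ℝ} (hT : HasLaw T τ P) (hU : HasLaw U (jitterMeasure σs) P)
    (hTU : IndepFun T U P) :
    HasLaw (channelGain hAtt ra ωb T U)
      (Measure.dirac (maxCollectedPower ra ωb * hAtt) ∗ₘ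
        (τ ∗ₘ powerMeasure ((equivBeamWidth ra ωb / (2 * σs)) ^ 2))) P := by
  have hV := hasLaw_exp_neg_radius_sq (equivBeamWidth_pos hra hωb) hσs
  have hVU := hV.comp hU
  have := hT.isProbabilityMeasure_iff.1 ‹_›
  have := hVU.isProbabilityMeasure_iff.1 ‹_›
  have hind := hTU.comp measurable_id (ψ := fun u : ℝ × ℝ =>
    Real.exp (-(2 * √(u.1 ^ 2 + u.2 ^ 2) ^ 2) / equivBeamWidth ra ωb ^ 2)) (by fun_prop)
  have hprod := hind.hasLaw_fun_mul hT hVU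
  have hscale : HasLaw (fun y => maxCollectedPower ra ωb * hAtt * y)
      (Measure.dirac (maxCollectedPower ra ωb * hAtt) ∗ₘ
        (τ ∗ₘ powerMeasure ((equivBeamWidth ra ωb / (2 * σs)) ^ 2)))
      (τ ∗ₘ powerMeasure ((equivBeamWidth ra ωb / (2 * σs)) ^ 2)) :=
    ⟨by fun_prop, (Measure.dirac_mconv _ _).symm⟩
  refine (hscale.comp hprod).congr (Filter.Eventually.of_forall fun ω => ?_)
  simp only [channelGain, pointingLoss, Function.comp_apply]
  ring

end

theorem theorem2
    {Ω : Type*} [MeasurableSpace Ω] (P : Measure Ω) [IsProbabilityMeasure P]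
    -- attenuation coefficients and distance; aperture radius, beam waist, jitter deviation
    (kAbs kScat d ra ωb σs : ℝ) (hra : 0 < ra) (hωb : 0 < ωb) (hσs : 0 < σs)
    -- parameters of the turbulence law
    (α β a b c : ℝ) (hα : α ∈ Set.Icc (0 : ℝ) 1) (hβ : 0 < β) (ha : 0 < a) (hb : 0 < b)
    (hc : 0 < c)
    -- the derived constants `h_a`, `A₀` and `μ_s`
    (hAtt A₀ μs : ℝ) (hhAtt : hAtt = attenuation kAbs kScat d)
    (hA₀ : A₀ = maxCollectedPower ra ωb) (hμs : μs = equivBeamWidth ra ωb / (2 * σs))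
    -- turbulence fadings and beam displacements of the two links
    (T₁ T₂ : Ω → ℝ) (U₁ U₂ : Ω → ℝ × ℝ)
    (hT₁ : HasLaw T₁ (eggMeasure α β a b c) P) (hT₂ : HasLaw T₂ (eggMeasure α β a b c) P)
    (hU₁ : HasLaw U₁ (jitterMeasure σs) P) (hU₂ : HasLaw U₂ (jitterMeasure σs) P)
    (hTU₁ : IndepFun T₁ U₁ P) (hTU₂ : IndepFun T₂ U₂ P)
    -- the two channel gains
    (h₁ h₂ : Ω → ℝ) (hh₁ : h₁ = channelGain hAtt ra ωb T₁ U₁)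
    (hh₂ : h₂ = channelGain hAtt ra ωb T₂ U₂) (hindep : IndepFun h₁ h₂ P) :
    -- the special functions in the formula are given by convergent Mellin-Barnes integrals
    (∀ x : ℝ, 0 < x →
      MeijerGWellDefined 4 0 [μs ^ 2 + 1, μs ^ 2 + 1] [1, μs ^ 2, 1, μs ^ 2]
        (x / (A₀ * hAtt * β) ^ 2) ∧
      FoxHWellDefined 4 0 [(μs ^ 2 / c + 1, 1 / c), (μs ^ 2 / c + 1, 1 / c)]
        [(a, 1 / c), (μs ^ 2 / c, 1 / c), (1, 1), (μs ^ 2 / c, 1 / c)]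
        (x / ((A₀ * hAtt) ^ 2 * β * b)) ∧
      MeijerGWellDefined 4 0 [μs ^ 2 / c + 1, μs ^ 2 / c + 1] [a, μs ^ 2 / c, a, μs ^ 2 / c]
        ((x / (A₀ * hAtt * b) ^ 2) ^ c)) ∧
    -- and the formula is the density of `h₁ h₂`, which is concentrated on `(0, ∞)`
    ∃ f : ℝ → ℝ, Measurable f ∧ (∀ x, 0 ≤ f x) ∧ (∀ x, x ≤ 0 → f x = 0) ∧
      (∀ x : ℝ, 0 < x → (f x : ℂ) =
        ((α * μs ^ 2) ^ 2 / x : ℝ) *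
          meijerG 4 0 [μs ^ 2 + 1, μs ^ 2 + 1] [1, μs ^ 2, 1, μs ^ 2]
            (x / (A₀ * hAtt * β) ^ 2) +
        (2 * α * (1 - α) * μs ^ 4 / (Real.Gamma a * c ^ 2 * x) : ℝ) *
          foxH 4 0 [(μs ^ 2 / c + 1, 1 / c), (μs ^ 2 / c + 1, 1 / c)]
            [(a, 1 / c), (μs ^ 2 / c, 1 / c), (1, 1), (μs ^ 2 / c, 1 / c)]
            (x / ((A₀ * hAtt) ^ 2 * β * b)) +
        (((1 - α) * μs ^ 2 / Real.Gamma a) ^ 2 * (1 / (c * x)) : ℝ) *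
          meijerG 4 0 [μs ^ 2 / c + 1, μs ^ 2 / c + 1] [a, μs ^ 2 / c, a, μs ^ 2 / c]
            ((x / (A₀ * hAtt * b) ^ 2) ^ c)) ∧
      HasLaw (fun ω => h₁ ω * h₂ ω) (volume.withDensity fun x => ENNReal.ofReal (f x)) P := by
  have hμ : 0 < μs := by
    rw [hμs]
    have := equivBeamWidth_pos hra hωb
    positivity
  have hA : 0 < A₀ := hA₀ ▸ maxCollectedPower_pos hra hωb
  have hh : 0 < hAtt := hhAtt ▸ Real.exp_pos _
  have hφ : 0 < μs ^ 2 := by positivity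
  have hK : 0 < (A₀ * hAtt) ^ 2 := by positivity
  have hα' : 0 ≤ 1 - α := by linarith [hα.2]
  have hG := Real.Gamma_pos_of_pos ha
  -- The pairs are exponential-exponential, Gamma-exponential and Gamma-Gamma. With c = 1 the first
  -- Fox function is already a Meijer function; the third becomes one through the power c of its
  -- argument.
  have case₁ := fun (x : ℝ) (hx : 0 < x) =>
    foxH_eq_integral_logKernel one_pos hβ one_pos one_pos hβ one_pos one_pos hφ
      (div_pos hx hK)
  have case₂ := fun (x : ℝ) (hx : 0 < x) =>
    foxH_eq_integral_logKernel ha hb hc one_pos hβ one_pos hc hφ (div_pos hx hK)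
  have case₃ := fun (x : ℝ) (hx : 0 < x) =>
    foxH_rpow_eq_integral_logKernel ha hb ha hb hc hφ (div_pos hx hK)
  simp only [div_self one_ne_zero, div_one] at case₁ case₂
  have arg₁ : ∀ x : ℝ, x / (A₀ * hAtt) ^ 2 / (β * β) = x / (A₀ * hAtt * β) ^ 2 := fun x => by
    rw [div_div]; ring_nf
  have arg₂ : ∀ x : ℝ, x / (A₀ * hAtt) ^ 2 / (b * β) = x / ((A₀ * hAtt) ^ 2 * β * b) := fun x => by
    rw [div_div]; ring_nf
  have arg₃ : ∀ x : ℝ, x / (A₀ * hAtt) ^ 2 / (b * b) = x / (A₀ * hAtt * b) ^ 2 := fun x => by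
    rw [div_div]; ring_nf
  simp only [arg₁] at case₁
  simp only [arg₂] at case₂
  simp only [arg₃] at case₃
  simp only [MeijerGWellDefined, meijerG, unitWeights, List.map_cons, List.map_nil]
  refine ⟨fun x hx => ⟨(case₁ x hx).1, (case₂ x hx).1, (case₃ x hx).1⟩, ?_⟩
  have hint : ∀ {a₁ b₁ c₁ a₂ b₂ c₂ x : ℝ}, 0 < a₁ → 0 < b₁ → 0 < c₁ → 0 < a₂ → 0 < b₂ → 0 < c₂ →
      0 < x → Integrable (fun p : ℝ × ℝ => logKernel (μs ^ 2) (x / (A₀ * hAtt) ^ 2 / (p.1 * p.2)))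
        ((genGammaMeasure a₁ b₁ c₁).prod (genGammaMeasure a₂ b₂ c₂)) :=
    fun h₁ h₂ h₃ h₄ h₅ h₆ hx => (integral_logKernel_genGamma_prod (σ := 0) h₁ h₂ h₃ h₄ h₅ h₆
      (div_pos hx hK) hφ (by simpa) (by simpa)).1
  have mix := fun (x : ℝ) (hx : 0 < x) => integral_prod_self_mixture
    (F := fun p : ℝ × ℝ => logKernel (μs ^ 2) (x / (A₀ * hAtt) ^ 2 / (p.1 * p.2)))
    (fun p => by simp [mul_comm]) (ENNReal.ofReal_ne_top (r := α))
    (ENNReal.ofReal_ne_top (r := 1 - α))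
    (hint one_pos hβ one_pos one_pos hβ one_pos hx) (hint ha hb hc one_pos hβ one_pos hx)
    (hint ha hb hc ha hb hc hx)
  simp only [← eggMeasure_eq_mixture hα hβ ha hb hc, ENNReal.toReal_ofReal hα.1,
    ENNReal.toReal_ofReal hα'] at mix
  have := hT₁.isProbabilityMeasure_iff.1 ‹_›
  refine ⟨compositePDF (eggMeasure α β a b c) (μs ^ 2) ((A₀ * hAtt) ^ 2),
    measurable_compositePDF _ _ _, compositePDF_nonneg _ _ _,
    fun x hx => if_neg (not_lt.2 hx), fun x hx => ?_, ?_⟩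
  -- The prefactors cancel the Gamma values and the powers c², c that the special functions carry
  -- relative to the expectations.
  · rw [(case₁ x hx).2, (case₂ x hx).2, (case₃ x hx).2, compositePDF, if_pos hx, (mix x hx).2,
      Real.Gamma_one, one_pow, one_mul, one_mul, mul_one]
    norm_cast
    field_simp
  · have l₁ := hasLaw_channelGain (hAtt := hAtt) hra hωb hσs hT₁ hU₁ hTU₁
    have l₂ := hasLaw_channelGain (hAtt := hAtt) hra hωb hσs hT₂ hU₂ hTU₂
    rw [← hh₁, ← hA₀, ← hμs] at l₁
    rw [← hh₂, ← hA₀, ← hμs] at l₂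
    have := l₁.isProbabilityMeasure_iff.1 ‹_›
    have l := hindep.hasLaw_fun_mul l₁ l₂
    -- Two exchanges of middle factors group the constants, the turbulence laws and the pointing
    -- laws; the constants merge into (A₀ h_a)².
    rwa [mconv_mconv_mconv_comm, mconv_mconv_mconv_comm (eggMeasure α β a b c),
      Measure.dirac_mconv_dirac, ← Measure.mconv_assoc, ← sq,
      dirac_mconv_mconv_powerMeasure (ae_pos_eggMeasure α β a b c) hφ hK
        (fun x hx => (mix x hx).1)] at l
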